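/- Notation. For $1\le q\le\infty$ let $\frac1q+\frac1{q'}=1$ (with $\frac1\infty=0$), and let $\widehat f(y)=\int_{\mathbb R} f(x)e^{-2\pi i xy}\,dx$, extended to $f\in L^q(\mathbb R)$ in the sense of distributions. Let $\widehat L^{q}(\mathbb R)=\{h\in L^q(\mathbb R): h=\widehat g \text{ for some } g\in L^{q'}(\mathbb R)\}$, with the norm $\|h\|_{\widehat L^q}=\|\widehat h\|_{L^{q'}(\mathbb R)}$. For a complex Borel measure $\mu$ on $\mathbb R$ and $1\le p\le\infty$ let $$\|\mu\|_p^*=\sup\left\{\left|\int_{\mathbb R}h\,d\mu\right| : h\in\widehat L^{p'}(\mathbb R)\text{ continuous},\ \|h\|_{\widehat L^{p'}}\le1\right\}.$$ For a function $f:[0,\infty)\to\mathbb C$ of bounded variation let $\mu_f$ be the complex Borel measure $df$ that it generates, let $$\|f\|_{V_p^*}=\int_0^\infty x^{-1/p}\,\|\chi_{(x,2x)}\mu_f\|_p^*\,dx ,$$ where $\chi_{(x,2x)}\mu_f$ is the restriction of $\mu_f$ to $(x,2x)$, and let $V_p^*$ be the space of all $f:[0,\infty)\to\mathbb C$ of bounded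 variation with $\|f\|_{V_p^*}<\infty$. Proposition. Let $1<p_2<p_1\le\infty$. Then there is a continuous embedding $V_{p_1}^*\hookrightarrow V_{p_2}^*$, that is, $V_{p_1}^*\subseteq V_{p_2}^*$ and there is a constant $C<\infty$, depending only on $p_1$ and $p_2$, such that $\|f\|_{V_{p_2}^*}\le C\,\|f\|_{V_{p_1}^*}$ for every $f\in V_{p_1}^*$. -/

import Mathlib

open Set MeasureTheory
open scoped ENNReal NNReal SchwartzMap FourierTransform

noncomputable section

namespace LpMeasure

/-- `g` is the Fourier transform of `f` in the sense of distributions: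
`∫ g ψ = ∫ f ψ̂` for every Schwartz function `ψ`, where `ψ̂(y) = ∫ ψ(x) e^{-2πixy} dx`.
It is only used for `f` and `g` in Lebesgue spaces, where all these integrals converge. -/
def IsFourierTransformOf (g f : ℝ → ℂ) : Prop :=
  ∀ ψ : 𝓢(ℝ, ℂ), ∫ x, g x * ψ x = ∫ x, f x * (𝓕 ψ) x

/-- Membership in `L̂^q(ℝ)`: the functions `h ∈ L^q` with `h = ĝ` for some `g ∈ L^{q'}`. -/
def MemHatLp (q : ℝ≥0∞) (h : ℝ → ℂ) : Prop :=
  MemLp h q ∧ ∃ g : ℝ → ℂ, MemLp g q.conjExponent ∧ IsFourierTransformOf h g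

/-- The norm `‖h‖_{L̂^q} = ‖ĥ‖_{q'}`. The Fourier transform `k = ĥ ∈ L^{q'}` is unique up to
null sets, so the infimum is over one value (and is `∞` if `ĥ` is not in `L^{q'}`). -/
def hatLpNorm (q : ℝ≥0∞) (h : ℝ → ℂ) : ℝ≥0∞ :=
  ⨅ (k : ℝ → ℂ) (_ : MemLp k q.conjExponent) (_ : IsFourierTransformOf k h),
    eLpNorm k q.conjExponent

/-- The functional `‖μ‖_p^* = sup |∫ h dμ|`, the supremum being over `h ∈ L̂^{p'}` with
`‖h‖_{L̂^{p'}} ≤ 1`. Elements of `L̂^{p'}` are functions up to Lebesgue-null sets and `μ` may be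
singular, so `h` runs over the continuous representatives, for which `∫ h dμ` is determined. -/
def starNorm (p : ℝ≥0∞) (μ : VectorMeasure ℝ ℂ) : ℝ≥0∞ :=
  ⨆ (h : ℝ → ℂ) (_ : Continuous h) (_ : MemHatLp p.conjExponent h)
    (_ : hatLpNorm p.conjExponent h ≤ 1), ‖μ.integral h (ContinuousLinearMap.mul ℝ ℂ)‖ₑ

/-- The complex Borel measure `μ_f = df` on `ℝ`, carried by `[0, ∞)`, generated by a function `f`
of bounded variation on `[0, ∞)`. -/
def stieltjes {f : ℝ≥0 → ℂ} (hf : BoundedVariationOn f univ) : VectorMeasure ℝ ℂ :=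
  hf.vectorMeasure.map ((↑) : ℝ≥0 → ℝ)

/-- `‖f‖_{V_p^*} = ∫_0^∞ x^{-1/p} ‖χ_{(x,2x)} μ_f‖_p^* dx`, with `1/∞ = 0`. -/
def vStarNorm (p : ℝ≥0∞) {f : ℝ≥0 → ℂ} (hf : BoundedVariationOn f univ) : ℝ≥0∞ :=
  ∫⁻ x in Ioi (0 : ℝ),
    ENNReal.ofReal (x ^ (-(p⁻¹).toReal)) * starNorm p ((stieltjes hf).restrict (Ioo x (2 * x)))

/-- The space `V_p^*` of functions of bounded variation on `[0, ∞)` with `‖f‖_{V_p^*} < ∞`. -/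
def VStar (p : ℝ≥0∞) : Set (ℝ≥0 → ℂ) :=
  {f | ∃ hf : BoundedVariationOn f univ, vStarNorm p hf < ∞}

end LpMeasure

end

/-! A measure carried by `(x, 2x)` does not see a test function `h` change if `h` is multiplied by a
bump `φ(·/x)` equal to 1 there. On the Fourier side this correlates `ĥ ∈ L^{p₂}` with the inverse
transform of the bump, and Young's inequality then places the result in `L^{p₁}` at the cost of a
factor `C x^{1/p₂ - 1/p₁}`, by scaling. Dualizing, `‖χ_{(x,2x)}μ‖_{p₂}^* ≤ C x^{1/p₂ - 1/p₁}
‖χ_{(x,2x)}μ‖_{p₁}^*` (`starNorm_restrict_le`). The weight `x^{-1/p₂}` absorbs that power and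
becomes `x^{-1/p₁}`, so the integrands compare pointwise in `x`. -/

namespace LpMeasure

/-! ### Young's inequality: two endpoints and interpolation -/

section Young

variable {a b : ℝ → ℝ≥0∞} {P Q : ℝ}

theorem aemeasurable_mul_comp_sub (ha : AEMeasurable a) (hb : Measurable b) :
    AEMeasurable (fun q : ℝ × ℝ => a q.1 * b (q.1 - q.2)) (volume.prod volume) :=
  (ha.comp_fst).mul (hb.comp (measurable_fst.sub measurable_snd)).aemeasurable

/-- Hölder and translation invariance: the `L^P → L^∞` endpoint. -/
theorem lintegral_mul_comp_sub_le (ha : AEMeasurable a) (hb : Measurable b)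
    (hPQ : P.HolderConjugate Q) (z : ℝ) :
    ∫⁻ y, a y * b (y - z) ≤ (∫⁻ y, a y ^ P) ^ (1 / P) * (∫⁻ y, b y ^ Q) ^ (1 / Q) := by
  refine (ENNReal.lintegral_mul_le_Lp_mul_Lq volume hPQ ha
    (hb.comp (measurable_id.sub_const z)).aemeasurable).trans_eq ?_
  congr 2
  exact lintegral_sub_right_eq_self (fun y => b y ^ Q) z

/-- Hölder after splitting `b = b^{1/P} b^{1/Q}`; the last exponent is `P/Q = P - 1`. -/
theorem rpow_lintegral_mul_comp_sub_le (ha : AEMeasurable a) (hb : Measurable b)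
    (hPQ : P.HolderConjugate Q) (z : ℝ) :
    (∫⁻ y, a y * b (y - z)) ^ P ≤ (∫⁻ y, a y ^ P * b (y - z)) * (∫⁻ y, b y) ^ (P - 1) := by
  have hP := hPQ.pos
  have hbz : Measurable fun y => b (y - z) := hb.comp (measurable_id.sub_const z)
  have key := ENNReal.lintegral_mul_norm_pow_le (μ := volume)
    ((ha.pow_const P).mul hbz.aemeasurable) hbz.aemeasurable (p := P⁻¹) (q := Q⁻¹)
    (inv_nonneg.2 hP.le) (inv_nonneg.2 hPQ.symm.pos.le) hPQ.inv_add_inv_eq_one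
  have e : ∀ y, ((fun y => a y ^ P) * fun y => b (y - z)) y ^ P⁻¹ * b (y - z) ^ Q⁻¹
      = a y * b (y - z) := by
    intro y
    simp only [Pi.mul_apply]
    rw [ENNReal.mul_rpow_of_nonneg _ _ (inv_nonneg.2 hP.le), ← ENNReal.rpow_mul,
      mul_inv_cancel₀ hP.ne', ENNReal.rpow_one, mul_assoc,
      ← ENNReal.rpow_add_of_nonneg _ _ (inv_nonneg.2 hP.le) (inv_nonneg.2 hPQ.symm.pos.le),
      hPQ.inv_add_inv_eq_one, ENNReal.rpow_one]
  simp only [e] at key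
  refine (ENNReal.rpow_le_rpow key hP.le).trans_eq ?_
  rw [ENNReal.mul_rpow_of_nonneg _ _ hP.le, ← ENNReal.rpow_mul, ← ENNReal.rpow_mul,
    inv_mul_cancel₀ hP.ne', ENNReal.rpow_one, lintegral_sub_right_eq_self (fun y => b y) z]
  congr 2
  have := hPQ.inv_add_inv_eq_one
  have h2 : Q⁻¹ = 1 - P⁻¹ := by linarith
  rw [h2, sub_mul, inv_mul_cancel₀ hP.ne', one_mul]

/-- Integrating the pointwise bound in `z` by Tonelli gives the `L^P → L^P` endpoint, with norm
`‖b‖₁`. -/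
theorem lintegral_rpow_lintegral_mul_comp_sub_le (ha : AEMeasurable a) (hb : Measurable b)
    (hPQ : P.HolderConjugate Q) :
    ∫⁻ z, (∫⁻ y, a y * b (y - z)) ^ P ≤ (∫⁻ y, a y ^ P) * (∫⁻ y, b y) ^ P := by
  have hP := hPQ.pos
  have haP := aemeasurable_mul_comp_sub (ha.pow_const P) hb
  calc
    _ ≤ ∫⁻ z, (∫⁻ y, a y ^ P * b (y - z)) * (∫⁻ y, b y) ^ (P - 1) :=
      lintegral_mono fun z => rpow_lintegral_mul_comp_sub_le ha hb hPQ z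
    _ = (∫⁻ z, ∫⁻ y, a y ^ P * b (y - z)) * (∫⁻ y, b y) ^ (P - 1) :=
      lintegral_mul_const'' _ haP.lintegral_prod_left
    _ = (∫⁻ y, ∫⁻ z, a y ^ P * b (y - z)) * (∫⁻ y, b y) ^ (P - 1) := by
      rw [lintegral_lintegral_swap (f := fun y z => a y ^ P * b (y - z)) haP]
    _ = (∫⁻ y, a y ^ P * ∫⁻ z, b z) * (∫⁻ y, b y) ^ (P - 1) := by
      congr 1
      refine lintegral_congr fun y => ?_
      rw [lintegral_const_mul _ (f := fun z => b (y - z)) (hb.comp (measurable_id.const_sub y)),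
        lintegral_sub_left_eq_self (fun z => b z) y]
    _ = (∫⁻ y, a y ^ P) * (∫⁻ y, b y) ^ P := by
      rw [lintegral_mul_const'' _ (ha.pow_const P), mul_assoc]
      congr 1
      conv_lhs => rw [← ENNReal.rpow_one (∫⁻ z, b z), ← ENNReal.rpow_mul, one_mul]
      rw [← ENNReal.rpow_add_of_nonneg _ _ zero_le_one (by linarith [hPQ.lt])]
      congr 1
      ring

end Young

/-- Interpolation between `L^∞` and `L^P`. -/
theorem eLpNorm_le_of_enorm_le_of_lintegral_rpow_le {K : ℝ → ℂ} {P : ℝ} (hP : 0 < P)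
    {p : ℝ≥0∞} (hp : ENNReal.ofReal P ≤ p) {A B : ℝ≥0∞} (hAt : A ≠ ∞) (hA : ∀ z, ‖K z‖ₑ ≤ A)
    (hB : ∫⁻ z, ‖K z‖ₑ ^ P ≤ B ^ P) :
    eLpNorm K p volume ≤ A ^ (1 - P * (p⁻¹).toReal) * B ^ (P * (p⁻¹).toReal) := by
  rcases eq_or_ne p ∞ with rfl | hpt
  · simpa using eLpNormEssSup_le_of_ae_enorm_bound (Filter.Eventually.of_forall hA)
  have hPp : P ≤ p.toReal := by
    rw [← ENNReal.toReal_ofReal hP.le]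
    exact ENNReal.toReal_mono hpt hp
  have hpos : 0 < p.toReal := hP.trans_le hPp
  have hp0 : p ≠ 0 := fun h => by simp [h] at hpos
  rw [eLpNorm_eq_lintegral_rpow_enorm_toReal hp0 hpt, ENNReal.toReal_inv]
  calc
    _ ≤ (A ^ (p.toReal - P) * B ^ P) ^ (1 / p.toReal) := by
      refine ENNReal.rpow_le_rpow ?_ (by positivity)
      calc
        _ ≤ ∫⁻ z, A ^ (p.toReal - P) * ‖K z‖ₑ ^ P := by
          refine lintegral_mono fun z => ?_
          conv_lhs => rw [← sub_add_cancel p.toReal P]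
          rw [ENNReal.rpow_add_of_nonneg _ _ (by linarith) hP.le]
          exact mul_le_mul' (ENNReal.rpow_le_rpow (hA z) (by linarith)) le_rfl
        _ ≤ _ := by
          rw [lintegral_const_mul' _ _ (ENNReal.rpow_ne_top_of_nonneg (by linarith) hAt)]
          gcongr
    _ = _ := by
      rw [ENNReal.mul_rpow_of_nonneg _ _ (by positivity), ← ENNReal.rpow_mul, ← ENNReal.rpow_mul]
      congr 2 <;> field_simp

/-! ### Multipliers and distributional Fourier transforms -/

/-- The multiplier with symbol `𝓕 w`, acting on the Fourier side. -/
noncomputable def corr (k : ℝ → ℂ) (w : 𝓢(ℝ, ℂ)) (z : ℝ) : ℂ := ∫ y, k y * w (y - z)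

theorem enorm_corr_le (k : ℝ → ℂ) (w : 𝓢(ℝ, ℂ)) (z : ℝ) :
    ‖corr k w z‖ₑ ≤ ∫⁻ y, ‖k y‖ₑ * ‖w (y - z)‖ₑ := by
  simpa [corr, enorm_mul] using enorm_integral_le_lintegral_enorm (fun y => k y * w (y - z))

theorem aestronglyMeasurable_mul_comp_sub {k : ℝ → ℂ} (hk : AEStronglyMeasurable k)
    (w : 𝓢(ℝ, ℂ)) :
    AEStronglyMeasurable (fun q : ℝ × ℝ => k q.2 * w (q.2 - q.1)) (volume.prod volume) :=
  hk.comp_snd.mul (w.continuous.comp (continuous_snd.sub continuous_fst)).aestronglyMeasurable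

theorem aestronglyMeasurable_corr {k : ℝ → ℂ} (hk : AEStronglyMeasurable k) (w : 𝓢(ℝ, ℂ)) :
    AEStronglyMeasurable (corr k w) :=
  (aestronglyMeasurable_mul_comp_sub hk w).integral_prod_right'

/-- Fubini, justified by the uniform bound `hb`, moves the correlation onto the test function as `ψ
∗ w`, whose transform is a product. -/
theorem isFourierTransformOf_corr {k h : ℝ → ℂ} (hk : AEStronglyMeasurable k)
    (hkh : IsFourierTransformOf k h) (w : 𝓢(ℝ, ℂ)) {A : ℝ≥0∞} (hA : A ≠ ∞)
    (hb : ∀ z, ∫⁻ y, ‖k y‖ₑ * ‖w (y - z)‖ₑ ≤ A) :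
    IsFourierTransformOf (corr k w) (fun t => h t * (𝓕 w) t) := by
  intro ψ
  have hint : Integrable (fun q : ℝ × ℝ => k q.2 * w (q.2 - q.1) * ψ q.1)
      (volume.prod volume) := by
    have hm : AEStronglyMeasurable (fun q : ℝ × ℝ => k q.2 * w (q.2 - q.1) * ψ q.1)
        (volume.prod volume) :=
      (aestronglyMeasurable_mul_comp_sub hk w).mul
        (ψ.continuous.comp continuous_fst).aestronglyMeasurable
    refine ⟨hm, ?_⟩
    rw [hasFiniteIntegral_iff_enorm, lintegral_prod _ hm.enorm]
    calc
      _ ≤ ∫⁻ z, A * ‖ψ z‖ₑ := by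
        refine lintegral_mono fun z => ?_
        simp only [enorm_mul]
        rw [lintegral_mul_const' _ _ enorm_ne_top]
        gcongr
        exact hb z
      _ < ∞ := by
        rw [lintegral_const_mul' _ _ hA]
        exact ENNReal.mul_lt_top hA.lt_top ψ.integrable.2
  set χ := SchwartzMap.convolution (ContinuousLinearMap.mul ℂ ℂ) ψ w with hχ
  calc
    ∫ z, corr k w z * ψ z = ∫ z, ∫ y, k y * w (y - z) * ψ z := by
      simp only [corr, integral_mul_const]
    _ = ∫ y, ∫ z, k y * w (y - z) * ψ z :=
      integral_integral_swap (f := fun z y => k y * w (y - z) * ψ z) hint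
    _ = ∫ y, k y * χ y := by
      refine integral_congr_ae (Filter.Eventually.of_forall fun y => ?_)
      simp only [hχ, SchwartzMap.convolution_apply, convolution, ContinuousLinearMap.mul_apply']
      rw [← integral_const_mul]
      refine integral_congr_ae (Filter.Eventually.of_forall fun z => ?_)
      simp only
      ring
    _ = ∫ t, h t * (𝓕 χ) t := hkh χ
    _ = _ := by
      refine integral_congr_ae (Filter.Eventually.of_forall fun t => ?_)
      simp only [hχ, SchwartzMap.fourier_convolution, SchwartzMap.pairing_apply_apply,
        ContinuousLinearMap.mul_apply']
      ring

/-- Fourier inversion: `MemHatLp` wants `h` as a transform, whereas `hatLpNorm` measures the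
transform of `h`. -/
theorem IsFourierTransformOf.comp_neg {K h : ℝ → ℂ} (hK : IsFourierTransformOf K h) :
    IsFourierTransformOf h (fun y => K (-y)) := by
  intro ψ
  have := hK (𝓕⁻ ψ)
  rw [FourierTransform.fourier_fourierInv_eq] at this
  rw [← this, ← integral_neg_eq_self]
  refine integral_congr_ae (Filter.Eventually.of_forall fun y => ?_)
  simp [SchwartzMap.fourierInv_apply_eq]

theorem IsFourierTransformOf.const_mul {k h : ℝ → ℂ} (hk : IsFourierTransformOf k h) (c : ℂ) :
    IsFourierTransformOf (fun y => c * k y) (fun y => c * h y) := by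
  intro ψ
  simp only [mul_assoc, integral_const_mul, hk ψ]

/-! ### Dilated bumps and the scaling of the Young bounds -/

/-- The dilate `t ↦ φ (t / x)` of a Schwartz function. -/
noncomputable def dilate (φ : 𝓢(ℝ, ℂ)) (x : ℝ) (hx : x ≠ 0) : 𝓢(ℝ, ℂ) :=
  SchwartzMap.compCLMOfContinuousLinearEquiv ℂ
    (ContinuousLinearEquiv.unitsEquivAut ℝ (Units.mk0 x hx)⁻¹) φ

@[simp]
theorem dilate_apply (φ : 𝓢(ℝ, ℂ)) {x : ℝ} (hx : x ≠ 0) (t : ℝ) :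
    dilate φ x hx t = φ (t / x) := by
  simp [dilate, div_eq_mul_inv]

theorem fourierInv_dilate_apply (φ : 𝓢(ℝ, ℂ)) {x : ℝ} (hx : 0 < x) (y : ℝ) :
    (𝓕⁻ (dilate φ x hx.ne')) y = (x : ℂ) * (𝓕⁻ φ) (x * y) := by
  rw [SchwartzMap.fourierInv_coe, SchwartzMap.fourierInv_coe, Real.fourierInv_eq',
    Real.fourierInv_eq']
  have := Measure.integral_comp_div
    (fun v : ℝ => Complex.exp (↑(2 * Real.pi * inner ℝ v (x * y)) * Complex.I) • φ v) x
  rw [abs_of_pos hx, Complex.real_smul] at this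
  rw [← this]
  refine integral_congr_ae (Filter.Eventually.of_forall fun v => ?_)
  simp only [dilate_apply, RCLike.inner_apply, conj_trivial]
  congr 4
  field_simp

theorem enorm_ofReal_of_nonneg {r : ℝ} (hr : 0 ≤ r) : ‖(r : ℂ)‖ₑ = ENNReal.ofReal r := by
  rw [← ofReal_norm, Complex.norm_of_nonneg hr]

theorem lintegral_comp_mul_left_pos (f : ℝ → ℝ≥0∞) (hf : Measurable f) {x : ℝ} (hx : 0 < x) :
    ENNReal.ofReal x * ∫⁻ y, f (x * y) = ∫⁻ y, f y := by
  conv_rhs => rw [← Real.smul_map_volume_mul_left hx.ne']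
  rw [lintegral_smul_measure, lintegral_map hf (measurable_const_mul x), abs_of_pos hx, smul_eq_mul]

theorem lintegral_enorm_fourierInv_dilate_rpow (φ : 𝓢(ℝ, ℂ)) {x : ℝ} (hx : 0 < x) {Q : ℝ}
    (hQ : 0 ≤ Q) :
    ∫⁻ y, ‖(𝓕⁻ (dilate φ x hx.ne')) y‖ₑ ^ Q =
      ENNReal.ofReal x ^ (Q - 1) * ∫⁻ y, ‖(𝓕⁻ φ) y‖ₑ ^ Q := by
  have hx0 : ENNReal.ofReal x ≠ 0 := by simpa using hx
  rw [← lintegral_comp_mul_left_pos (fun y => ‖(𝓕⁻ φ : 𝓢(ℝ, ℂ)) y‖ₑ ^ Q)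
    ((𝓕⁻ φ : 𝓢(ℝ, ℂ)).continuous.measurable.enorm.pow_const Q) hx, ← mul_assoc]
  conv_rhs => enter [1, 2]; rw [← ENNReal.rpow_one (ENNReal.ofReal x)]
  rw [← ENNReal.rpow_add _ _ hx0 ENNReal.ofReal_ne_top, sub_add_cancel,
    ← lintegral_const_mul' _ _ (ENNReal.rpow_ne_top_of_nonneg hQ ENNReal.ofReal_ne_top)]
  refine lintegral_congr fun y => ?_
  rw [fourierInv_dilate_apply φ hx, enorm_mul, ENNReal.mul_rpow_of_nonneg _ _ hQ,
    enorm_ofReal_of_nonneg hx.le]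

theorem conjExponent_conjExponent {p : ℝ≥0∞} (hp : 1 ≤ p) :
    p.conjExponent.conjExponent = p :=
  haveI := (ENNReal.HolderConjugate.conjExponent hp).symm
  ENNReal.HolderConjugate.conjExponent_eq

/-- The constant in the comparison of `‖·‖_{p₂}^*` and `‖·‖_{p₁}^*` on dyadic intervals. -/
noncomputable def compConst (w : 𝓢(ℝ, ℂ)) (P s : ℝ) : ℝ≥0∞ :=
  2 * (((∫⁻ y, ‖w y‖ₑ ^ P.conjExponent) ^ (1 / P.conjExponent)) ^ (1 - P * s)
    * (∫⁻ y, ‖w y‖ₑ) ^ (P * s)) + 1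

theorem lintegral_enorm_rpow_ne_top (w : 𝓢(ℝ, ℂ)) {Q : ℝ} (hQ : 0 < Q) :
    ∫⁻ y, ‖w y‖ₑ ^ Q ≠ ∞ := by
  have := lintegral_rpow_enorm_lt_top_of_eLpNorm_lt_top (μ := volume) (f := w)
    (p := ENNReal.ofReal Q) (by simpa using hQ) ENNReal.ofReal_ne_top
    (w.memLp (ENNReal.ofReal Q) volume).2
  rw [ENNReal.toReal_ofReal hQ.le] at this
  exact this.ne

theorem compConst_ne_top (w : 𝓢(ℝ, ℂ)) {P s : ℝ} (hP : 1 < P) (hs : 0 ≤ s) (hPs : P * s ≤ 1) :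
    compConst w P s ≠ ∞ := by
  have hQ := (Real.HolderConjugate.conjExponent hP).symm.pos
  have h1 := lintegral_enorm_rpow_ne_top w zero_lt_one
  simp only [ENNReal.rpow_one] at h1
  refine ENNReal.add_ne_top.2 ⟨ENNReal.mul_ne_top (by simp) (ENNReal.mul_ne_top ?_ ?_), by simp⟩
  · exact ENNReal.rpow_ne_top_of_nonneg (by linarith) (ENNReal.rpow_ne_top_of_nonneg
      (by positivity) (lintegral_enorm_rpow_ne_top w hQ))
  · exact ENNReal.rpow_ne_top_of_nonneg (by positivity) h1

theorem lintegral_mul_fourierInv_dilate_le (φ : 𝓢(ℝ, ℂ)) {x : ℝ} (hx : 0 < x) {P : ℝ}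
    (hP : 1 < P) {a : ℝ → ℝ≥0∞} (ha : AEMeasurable a) (z : ℝ) :
    ∫⁻ y, a y * ‖(𝓕⁻ (dilate φ x hx.ne')) (y - z)‖ₑ ≤
      (∫⁻ y, a y ^ P) ^ (1 / P) * (ENNReal.ofReal x ^ (1 / P) *
        (∫⁻ y, ‖(𝓕⁻ φ) y‖ₑ ^ P.conjExponent) ^ (1 / P.conjExponent)) := by
  have hPQ := Real.HolderConjugate.conjExponent hP
  have hQ := hPQ.symm.pos
  refine (lintegral_mul_comp_sub_le ha
    (𝓕⁻ (dilate φ x hx.ne')).continuous.measurable.enorm hPQ z).trans_eq ?_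
  rw [lintegral_enorm_fourierInv_dilate_rpow φ hx hQ.le,
    ENNReal.mul_rpow_of_nonneg _ _ (by positivity), ← ENNReal.rpow_mul]
  congr 3
  have := hPQ.inv_add_inv_eq_one
  rw [sub_mul, mul_one_div_cancel hQ.ne']
  simp only [one_div]
  linarith

/-- The `L¹` norm of the kernel is dilation invariant, so `x` enters only through the sup bound
`x^{1/P}`, raised to the power `1 - P/p₁`. -/
theorem eLpNorm_corr_fourierInv_dilate_le (φ : 𝓢(ℝ, ℂ)) {x : ℝ} (hx : 0 < x) {p₁ p₂ : ℝ≥0∞}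
    (hp₂ : 1 < p₂) (hp : p₂ < p₁) {k : ℝ → ℂ} (hk : MemLp k p₂) (hk2 : eLpNorm k p₂ ≤ 2) :
    eLpNorm (corr k (𝓕⁻ (dilate φ x hx.ne'))) p₁ ≤
      ENNReal.ofReal x ^ ((p₂⁻¹).toReal - (p₁⁻¹).toReal) *
        compConst (𝓕⁻ φ) p₂.toReal (p₁⁻¹).toReal := by
  have hp₂t : p₂ ≠ ∞ := hp.ne_top
  have hp₂0 : p₂ ≠ 0 := (zero_lt_one.trans hp₂).ne'
  have hP : 1 < p₂.toReal := by
    simpa using (ENNReal.toReal_lt_toReal ENNReal.one_ne_top hp₂t).2 hp₂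
  set P := p₂.toReal with hPdef
  set s := (p₁⁻¹).toReal with hs
  have hP0 : 0 < P := zero_lt_one.trans hP
  have hPQ := Real.HolderConjugate.conjExponent hP
  have hQ := hPQ.symm.pos
  have hs0 : 0 ≤ s := ENNReal.toReal_nonneg
  have hsP : s ≤ P⁻¹ := by
    rw [hs, hPdef, ← ENNReal.toReal_inv]
    exact ENNReal.toReal_mono (ENNReal.inv_ne_top.2 hp₂0) (ENNReal.inv_le_inv.2 hp.le)
  have hPs : P * s ≤ 1 := by
    calc P * s ≤ P * P⁻¹ := by gcongr
      _ = 1 := mul_inv_cancel₀ hP0.ne'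
  have ha : AEMeasurable (fun y => ‖k y‖ₑ) := hk.1.enorm
  have hkP : (∫⁻ y, ‖k y‖ₑ ^ P) ^ (1 / P) ≤ 2 := by
    rwa [← eLpNorm_eq_lintegral_rpow_enorm_toReal hp₂0 hp₂t]
  set W := (∫⁻ y, ‖(𝓕⁻ φ) y‖ₑ ^ P.conjExponent) ^ (1 / P.conjExponent) with hW
  set V := ∫⁻ y, ‖(𝓕⁻ φ) y‖ₑ with hV
  have hWt : W ≠ ∞ := ENNReal.rpow_ne_top_of_nonneg (by positivity)
    (lintegral_enorm_rpow_ne_top _ hQ)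
  have hA : ∀ z, ‖corr k (𝓕⁻ (dilate φ x hx.ne')) z‖ₑ ≤ 2 * (ENNReal.ofReal x ^ (1 / P) * W) :=
    fun z => (enorm_corr_le _ _ z).trans
      ((lintegral_mul_fourierInv_dilate_le φ hx hP ha z).trans (by gcongr))
  have hAt : 2 * (ENNReal.ofReal x ^ (1 / P) * W) ≠ ∞ :=
    ENNReal.mul_ne_top (by simp) (ENNReal.mul_ne_top
      (ENNReal.rpow_ne_top_of_nonneg (by positivity) ENNReal.ofReal_ne_top) hWt)
  have hB : ∫⁻ z, ‖corr k (𝓕⁻ (dilate φ x hx.ne')) z‖ₑ ^ P ≤ (2 * V) ^ P := by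
    calc
      _ ≤ ∫⁻ z, (∫⁻ y, ‖k y‖ₑ * ‖(𝓕⁻ (dilate φ x hx.ne')) (y - z)‖ₑ) ^ P :=
        lintegral_mono fun z => ENNReal.rpow_le_rpow (enorm_corr_le _ _ z) hP0.le
      _ ≤ _ := lintegral_rpow_lintegral_mul_comp_sub_le ha
        (𝓕⁻ (dilate φ x hx.ne')).continuous.measurable.enorm hPQ
      _ ≤ _ := by
        have h1 := lintegral_enorm_fourierInv_dilate_rpow φ hx zero_le_one
        simp only [ENNReal.rpow_one, sub_self, ENNReal.rpow_zero, one_mul] at h1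
        rw [h1, ENNReal.mul_rpow_of_nonneg _ _ hP0.le]
        gcongr
        have := ENNReal.rpow_le_rpow hkP hP0.le
        rwa [← ENNReal.rpow_mul, one_div_mul_cancel hP0.ne', ENNReal.rpow_one] at this
  have hPp : ENNReal.ofReal P ≤ p₁ := by rw [hPdef, ENNReal.ofReal_toReal hp₂t]; exact hp.le
  refine (eLpNorm_le_of_enorm_le_of_lintegral_rpow_le hP0 hPp hAt hA hB).trans ?_
  have h1s : 0 ≤ 1 - P * s := by linarith
  have hPs0 : 0 ≤ P * s := by positivity
  rw [← hs, ENNReal.mul_rpow_of_nonneg _ _ h1s, ENNReal.mul_rpow_of_nonneg _ _ h1s,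
    ENNReal.mul_rpow_of_nonneg _ _ hPs0, ← ENNReal.rpow_mul]
  have hexp : 1 / P * (1 - P * s) = (p₂⁻¹).toReal - s := by
    rw [ENNReal.toReal_inv, ← hPdef]
    field_simp
  have h2 : (2 : ℝ≥0∞) ^ (1 - P * s) * 2 ^ (P * s) = 2 := by
    rw [← ENNReal.rpow_add_of_nonneg _ _ h1s hPs0, sub_add_cancel, ENNReal.rpow_one]
  rw [hexp]
  calc
    _ = ENNReal.ofReal x ^ ((p₂⁻¹).toReal - s) *
        ((2 : ℝ≥0∞) ^ (1 - P * s) * 2 ^ (P * s) * (W ^ (1 - P * s) * V ^ (P * s))) := by ring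
    _ ≤ _ := by
      rw [h2, compConst]
      exact mul_le_mul' le_rfl le_self_add

/-! ### Comparison of the dual norms and the embedding -/

/-- Reverse Hölder (Nikolskii type) comparison on a dyadic interval. -/
theorem starNorm_restrict_le (φ : 𝓢(ℝ, ℂ)) (hφ : ∀ t ∈ Ioo (1 : ℝ) 2, φ t = 1)
    (hφc : HasCompactSupport φ) {x : ℝ} (hx : 0 < x) {p₁ p₂ : ℝ≥0∞}
    (hp₂ : 1 < p₂) (hp : p₂ < p₁) (μ : VectorMeasure ℝ ℂ) :
    starNorm p₂ (μ.restrict (Ioo x (2 * x))) ≤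
      ENNReal.ofReal x ^ ((p₂⁻¹).toReal - (p₁⁻¹).toReal) *
        compConst (𝓕⁻ φ) p₂.toReal (p₁⁻¹).toReal *
          starNorm p₁ (μ.restrict (Ioo x (2 * x))) := by
  have hp₁ : 1 ≤ p₁ := (hp₂.trans hp).le
  have hp₂t : p₂ ≠ ∞ := hp.ne_top
  have hp₂0 : p₂ ≠ 0 := (zero_lt_one.trans hp₂).ne'
  have hP : 1 < p₂.toReal := by
    simpa using (ENNReal.toReal_lt_toReal ENNReal.one_ne_top hp₂t).2 hp₂
  have hPs : p₂.toReal * (p₁⁻¹).toReal ≤ 1 := by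
    rw [← ENNReal.toReal_mul, ← ENNReal.toReal_one]
    refine ENNReal.toReal_mono ENNReal.one_ne_top ?_
    rw [← div_eq_mul_inv]
    exact ENNReal.div_le_of_le_mul (by simpa using hp.le)
  set M := ENNReal.ofReal x ^ ((p₂⁻¹).toReal - (p₁⁻¹).toReal) *
    compConst (𝓕⁻ φ) p₂.toReal (p₁⁻¹).toReal with hM
  have hx0 : ENNReal.ofReal x ≠ 0 := by simpa using hx
  have hMt : M ≠ ∞ := ENNReal.mul_ne_top (ENNReal.rpow_ne_top_of_ne_zero hx0 ENNReal.ofReal_ne_top)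
    (compConst_ne_top _ hP ENNReal.toReal_nonneg hPs)
  -- The summand `+ 1` in `compConst` is there for this: `M` must be invertible.
  have hM0 : M ≠ 0 := mul_ne_zero
    (ENNReal.rpow_pos (pos_iff_ne_zero.2 hx0) ENNReal.ofReal_ne_top |>.ne')
    (by simp [compConst])
  refine iSup_le fun h => iSup_le fun hc => iSup_le fun _ => iSup_le fun hn => ?_
  rw [hatLpNorm, conjExponent_conjExponent hp₂.le] at hn
  -- The norm is an infimum; relaxing 1 to 2 yields an actual `k` without proving uniqueness of the
  -- transform.
  have hn2 := hn.trans_lt (ENNReal.one_lt_two)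
  simp only [iInf_lt_iff] at hn2
  obtain ⟨k, hk, hkh, hk2⟩ := hn2
  set w := 𝓕⁻ (dilate φ x hx.ne') with hw
  have hKbd := eLpNorm_corr_fourierInv_dilate_le φ hx hp₂ hp hk hk2.le
  have hK : MemLp (corr k w) p₁ := ⟨aestronglyMeasurable_corr hk.1 w, hKbd.trans_lt hMt.lt_top⟩
  have hFT : IsFourierTransformOf (corr k w) (fun t => h t * φ (t / x)) := by
    have hb := lintegral_mul_fourierInv_dilate_le φ hx hP hk.1.enorm
    have := isFourierTransformOf_corr hk.1 hkh w (A := _) ?_ hb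
    · simpa [hw, FourierTransform.fourier_fourierInv_eq] using this
    · have hQ := (Real.HolderConjugate.conjExponent hP).symm.pos
      refine ENNReal.mul_ne_top ?_ (ENNReal.mul_ne_top
        (ENNReal.rpow_ne_top_of_nonneg (by positivity) ENNReal.ofReal_ne_top)
        (ENNReal.rpow_ne_top_of_nonneg (by positivity) (lintegral_enorm_rpow_ne_top _ hQ)))
      rw [← eLpNorm_eq_lintegral_rpow_enorm_toReal hp₂0 hp₂t]
      exact hk.2.ne
  -- Dividing by `M` makes `h'` admissible in the supremum for `p₁`.
  set c : ℂ := ((M.toReal⁻¹ : ℝ) : ℂ) with hcdef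
  have hMpos : 0 < M.toReal := ENNReal.toReal_pos hM0 hMt
  have hFTc := hFT.const_mul c
  set h' : ℝ → ℂ := fun t => c * (h t * φ (t / x)) with hh'
  have hc' : Continuous h' :=
    continuous_const.mul (hc.mul (φ.continuous.comp (continuous_id.div_const x)))
  have hcs : HasCompactSupport h' := by
    have : HasCompactSupport (dilate φ x hx.ne') := by
      have := hφc.comp_homeomorph (Homeomorph.mulRight₀ x⁻¹ (inv_ne_zero hx.ne'))
      convert this using 1
      ext t
      simp [div_eq_mul_inv]
    simp only [hh', ← dilate_apply φ hx.ne']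
    exact (this.mul_left (f := h)).mul_left (f := fun _ => c)
  have hmem : MemHatLp p₁.conjExponent h' := by
    refine ⟨hc'.memLp_of_hasCompactSupport hcs, _, ?_, hFTc.comp_neg⟩
    rw [conjExponent_conjExponent hp₁]
    exact (hK.const_mul c).comp_measurePreserving (Measure.measurePreserving_neg volume)
  have hnorm : hatLpNorm p₁.conjExponent h' ≤ 1 := by
    rw [hatLpNorm, conjExponent_conjExponent hp₁]
    have hinf : (⨅ (g : ℝ → ℂ) (_ : MemLp g p₁) (_ : IsFourierTransformOf g h'), eLpNorm g p₁) ≤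
        eLpNorm (fun y => c * corr k w y) p₁ :=
      iInf_le_of_le _ (iInf_le_of_le (hK.const_mul c) (iInf_le_of_le hFTc le_rfl))
    refine hinf.trans ?_
    have : eLpNorm (fun y => c * corr k w y) p₁ = ‖c‖ₑ * eLpNorm (corr k w) p₁ :=
      eLpNorm_const_smul c (corr k w) p₁ volume
    rw [this, hcdef, enorm_ofReal_of_nonneg (by positivity),
      ENNReal.ofReal_inv_of_pos hMpos, ENNReal.ofReal_toReal hMt]
    calc
      _ ≤ M⁻¹ * M := by gcongr
      _ = 1 := ENNReal.inv_mul_cancel hM0 hMt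
  have hle : ‖(μ.restrict (Ioo x (2 * x))).integral h' (ContinuousLinearMap.mul ℝ ℂ)‖ₑ ≤
      starNorm p₁ (μ.restrict (Ioo x (2 * x))) :=
    le_iSup_of_le h' (le_iSup_of_le hc' (le_iSup_of_le hmem (le_iSup_of_le hnorm le_rfl)))
  -- The restricted measure only sees `(x, 2x)`, where the bump is 1 and `h = M h'`.
  have heq : (μ.restrict (Ioo x (2 * x))).integral h (ContinuousLinearMap.mul ℝ ℂ) =
      M.toReal • (μ.restrict (Ioo x (2 * x))).integral h' (ContinuousLinearMap.mul ℝ ℂ) := by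
    rw [← VectorMeasure.integral_smul]
    refine VectorMeasure.integral_congr_ae ?_
    rw [VectorMeasure.variation_restrict measurableSet_Ioo]
    filter_upwards [ae_restrict_mem measurableSet_Ioo] with t ht
    have h1 : φ (t / x) = 1 :=
      hφ _ ⟨(one_lt_div hx).2 ht.1, (div_lt_iff₀ hx).2 ht.2⟩
    have hMc : (M.toReal : ℂ) ≠ 0 := by exact_mod_cast hMpos.ne'
    simp [h1, hcdef, hMc]
  rw [heq, enorm_smul, Real.enorm_of_nonneg hMpos.le, ENNReal.ofReal_toReal hMt]
  gcongr

theorem exists_schwartzMap_eq_one_on_Ioo :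
    ∃ φ : 𝓢(ℝ, ℂ), (∀ t ∈ Ioo (1 : ℝ) 2, φ t = 1) ∧ HasCompactSupport φ := by
  let b : ContDiffBump (3 / 2 : ℝ) := ⟨1 / 2, 1, by norm_num, by norm_num⟩
  have hs : HasCompactSupport fun t => (b t : ℂ) :=
    b.hasCompactSupport.comp_left (g := ((↑) : ℝ → ℂ)) Complex.ofReal_zero
  refine ⟨hs.toSchwartzMap (Complex.ofRealCLM.contDiff.comp b.contDiff), fun t ht => ?_, hs⟩
  have : b t = 1 := b.one_of_mem_closedBall <| by
    rw [Metric.mem_closedBall, Real.dist_eq, abs_le]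
    constructor <;> norm_num [b] <;> linarith [ht.1, ht.2]
  change (b t : ℂ) = 1
  rw [this, Complex.ofReal_one]

theorem exists_vStarNorm_le {p₁ p₂ : ℝ≥0∞} (hp₂ : 1 < p₂) (hp : p₂ < p₁) :
    ∃ C : ℝ≥0, ∀ (f : ℝ≥0 → ℂ) (hf : BoundedVariationOn f univ),
      vStarNorm p₂ hf ≤ C * vStarNorm p₁ hf := by
  obtain ⟨φ, hφ, hφc⟩ := exists_schwartzMap_eq_one_on_Ioo
  have hp₂t : p₂ ≠ ∞ := hp.ne_top
  have hP : 1 < p₂.toReal := by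
    simpa using (ENNReal.toReal_lt_toReal ENNReal.one_ne_top hp₂t).2 hp₂
  have hPs : p₂.toReal * (p₁⁻¹).toReal ≤ 1 := by
    rw [← ENNReal.toReal_mul, ← ENNReal.toReal_one]
    refine ENNReal.toReal_mono ENNReal.one_ne_top ?_
    rw [← div_eq_mul_inv]
    exact ENNReal.div_le_of_le_mul (by simpa using hp.le)
  have hCt := compConst_ne_top (𝓕⁻ φ) hP ENNReal.toReal_nonneg hPs
  refine ⟨(compConst (𝓕⁻ φ) p₂.toReal (p₁⁻¹).toReal).toNNReal, fun f hf => ?_⟩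
  -- Finiteness of the constant lets it leave the integral with no measurability in `x` of the dual
  -- norm.
  rw [ENNReal.coe_toNNReal hCt, vStarNorm, vStarNorm, ← lintegral_const_mul' _ _ hCt]
  refine setLIntegral_mono' measurableSet_Ioi fun x (hx : 0 < x) => ?_
  have hx0 : ENNReal.ofReal x ≠ 0 := by simpa using hx
  calc
    _ ≤ _ := mul_le_mul' le_rfl (starNorm_restrict_le φ hφ hφc hx hp₂ hp (stieltjes hf))
    _ = _ := by
      have : ENNReal.ofReal (x ^ (-(p₂⁻¹).toReal)) *
          ENNReal.ofReal x ^ ((p₂⁻¹).toReal - (p₁⁻¹).toReal) =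
          ENNReal.ofReal (x ^ (-(p₁⁻¹).toReal)) := by
        rw [← ENNReal.ofReal_rpow_of_pos hx, ← ENNReal.ofReal_rpow_of_pos hx,
          ← ENNReal.rpow_add _ _ hx0 ENNReal.ofReal_ne_top]
        congr 1
        ring
      rw [← this]
      ring

end LpMeasure

theorem mainTheorem11 (p₁ p₂ : ℝ≥0∞) (hp₂ : 1 < p₂) (hp : p₂ < p₁) :
    LpMeasure.VStar p₁ ⊆ LpMeasure.VStar p₂ ∧
      ∃ C : ℝ≥0, ∀ (f : ℝ≥0 → ℂ) (hf : BoundedVariationOn f univ), f ∈ LpMeasure.VStar p₁ →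
        LpMeasure.vStarNorm p₂ hf ≤ C * LpMeasure.vStarNorm p₁ hf := by
  obtain ⟨C, hC⟩ := LpMeasure.exists_vStarNorm_le hp₂ hp
  exact ⟨fun f ⟨hf, hfin⟩ => ⟨hf, (hC f hf).trans_lt (ENNReal.mul_lt_top ENNReal.coe_lt_top hfin)⟩,
    C, fun f hf _ => hC f hf⟩
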